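/- For an integer $d\ge 0$, let $GMM_d(\infty)$ be the set of finite Gaussian mixtures on $\mathbb{R}^d$, i.e. probability measures of the form $\sum_{k=1}^K \pi_k\,\mathcal N(m_k,\Sigma_k)$ with $K\ge 1$, $\pi_k\ge 0$, $\sum_k\pi_k=1$, $m_k\in\mathbb R^d$ and $\Sigma_k$ symmetric positive semidefinite (possibly singular); define $GMM_{2d}(\infty)$ likewise on $\mathbb R^{2d}=\mathbb R^d\times\mathbb R^d$. For $\mu_0,\mu_1\in GMM_d(\infty)$ let $\Pi(\mu_0,\mu_1)$ be the set of probability measures on $\mathbb R^d\times\mathbb R^d$ with marginals $\mu_0$ and $\mu_1$, and set $$MW_2(\mu_0,\mu_1)=\Bigl(\inf_{\gamma\in\Pi(\mu_0,\mu_1)\cap GMM_{2d}(\infty)}\int_{\mathbb R^d\times\mathbb R^d}\|x-y\|^2\,d\gamma(x,y)\Bigr)^{1/2},$$ where $\|\cdot\|$ is the Euclidean norm. Then $MW_2$ is a (finite) metric on $GMM_d(\infty)$, and $(GMM_d(\infty),MW_2)$ is a geodesic space: any two points $\mu_0,\mu_1$ are joined by a continuous path $(\rho_t)_{t\in[0,1]}$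 whose length $\sup_{0= t_0\le t_1\le\dots\le t_N= 1}\sum_{i=1}^N MW_2(\rho_{t_{i-1}},\rho_{t_i})$ equals $MW_2(\mu_0,\mu_1)$. More explicitly, for all $\mu_0,\mu_1\in GMM_d(\infty)$ the infimum defining $MW_2(\mu_0,\mu_1)$ is attained, and for every minimizer $\gamma^*$, with $P_t(x,y)=(1-t)x+ty$, the measures $\mu_t=(P_t)_\#\gamma^*$, $t\in[0,1]$, form a continuous path in $(GMM_d(\infty),MW_2)$ from $\mu_0$ to $\mu_1$ that satisfies $MW_2(\mu_s,\mu_t)=|t-s|\,MW_2(\mu_0,\mu_1)$ for all $s,t\in[0,1]$ and has length $MW_2(\mu_0,\mu_1)$. -/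

import Mathlib

open MeasureTheory ProbabilityTheory
open scoped ENNReal NNReal unitInterval

noncomputable section

/-- Gaussian mixtures on `E` with at most `K` components: the measures `∑ k, π k • g k` with
weights `π` in the simplex and `g k` Gaussian. Degenerate Gaussians (singular covariance, such as
Dirac masses) are allowed, as in Mathlib's `IsGaussian`; zero weights are allowed. -/
def GMMOfSize (E : Type*) [TopologicalSpace E] [AddCommMonoid E] [Module ℝ E]
    [MeasurableSpace E] (K : ℕ) : Set (Measure E) :=
  {μ | ∃ (π : Fin K → ℝ≥0) (g : Fin K → Measure E),
    ∑ k, π k = 1 ∧ (∀ k, IsGaussian (g k)) ∧ μ = ∑ k, π k • g k}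

/-- All finite Gaussian mixtures on `E`. -/
def GMM (E : Type*) [TopologicalSpace E] [AddCommMonoid E] [Module ℝ E]
    [MeasurableSpace E] : Set (Measure E) :=
  ⋃ K : ℕ, GMMOfSize E K

section Distance

variable {E : Type*} [NormedAddCommGroup E] [NormedSpace ℝ E] [MeasurableSpace E]

/-- The couplings of `μ` and `ν` (measures on `E × E` with marginals `μ` and `ν`) that are finite
Gaussian mixtures on `E × E`. -/
def gmmPlans (μ ν : Measure E) : Set (Measure (E × E)) :=
  {γ | γ.fst = μ ∧ γ.snd = ν} ∩ GMM (E × E)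

/-- The quadratic transport cost of a plan. -/
def transportCost (γ : Measure (E × E)) : ℝ≥0∞ :=
  ∫⁻ z, ENNReal.ofReal (‖z.1 - z.2‖ ^ 2) ∂γ

/-- The mixture Wasserstein distance, a priori with values in `[0, ∞]`. -/
def MW₂ (μ ν : Measure E) : ℝ≥0∞ :=
  (⨅ γ ∈ gmmPlans μ ν, transportCost γ) ^ (1 / 2 : ℝ)

/-- `γ` is an optimal plan for `MW₂`: an admissible plan of minimal cost. -/
def IsOptimalPlan (μ ν : Measure E) (γ : Measure (E × E)) : Prop :=
  γ ∈ gmmPlans μ ν ∧ ∀ γ' ∈ gmmPlans μ ν, transportCost γ ≤ transportCost γ'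

/-- The interpolation map `(x, y) ↦ (1 - t) x + t y`. -/
def interp (t : ℝ) (z : E × E) : E := (1 - t) • z.1 + t • z.2

end Distance

section Geodesics

variable {X : Type*} [MetricSpace X]

/-- The length of a path: the supremum over subdivisions of the sums of successive distances. -/
def pathLength {x y : X} (ρ : Path x y) : ℝ≥0∞ := eVariationOn ρ Set.univ

/-- A metric space is geodesic if any two points are joined by a (continuous) path whose length
is their distance. -/
def IsGeodesicSpace (X : Type*) [MetricSpace X] : Prop :=
  ∀ x y : X, ∃ ρ : Path x y, pathLength ρ = edist x y

/-- A constant-speed geodesic parametrised by `[0, 1]`. -/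
def IsConstantSpeedGeodesic {x y : X} (ρ : Path x y) : Prop :=
  ∀ s t : I, dist (ρ s) (ρ t) = |(t : ℝ) - s| * dist x y

end Geodesics

end

/-! ### Identifiability of finite Gaussian mixtures -/

section LinearIndependence

open Filter Asymptotics

/-! A finite Gaussian mixture is a finitely supported weight on the set of Gaussian measures, and
this weight is unique: some linear functional separates the finitely many components by mean and
variance, and the exponential moments along it grow at pairwise different rates
(`linearIndependent_isGaussian`). Hence a mixture plan between two mixtures projects to a coupling
of their weights (`mapDomain_fstGaussian`, `mapDomain_sndGaussian`), and minimising the cost becomes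
a discrete transport problem whose ground cost is the cheapest Gaussian plan between two components.
Both levels are compact minimisations: covariances with prescribed diagonal blocks
(`exists_optimal_gaussian_plan`) and finite couplings (`exists_optimal_discrete_coupling`). So the
infimum is attained.

The triangle inequality needs gluing inside the class of mixtures. Two Gaussian plans are glued as
measures, and the result is replaced by the Gaussian with the same moments, which keeps the two
given projections. For mixtures, uniqueness of the middle weights allows components to be matched by
their middle marginal (`exists_glued_mixture`). Minkowski's inequality in L² concludes.

For geodesics, pushing an optimal plan forward by two interpolation maps gives an admissible plan
whose root cost is `|t - s|` times the original one. The triangle inequality forces equality, and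
constant speed gives the length. -/

/-- Functions of pairwise different orders of growth are linearly independent. -/
theorem linearIndependent_of_isLittleO {ι X : Type*} [LinearOrder ι] {l : Filter X}
    {f : ι → X → ℝ} (hlt : ∀ i j, i < j → f i =o[l] f j) (hne : ∀ i, ∃ᶠ x in l, f i x ≠ 0) :
    LinearIndependent ℝ f := by
  rw [linearIndependent_iff']
  intro s c hc
  by_contra! hcon
  obtain ⟨i, his, hci⟩ := hcon
  have hnon : (s.filter fun i => c i ≠ 0).Nonempty := ⟨i, by simp [his, hci]⟩
  -- The fastest growing function with a nonzero coefficient cannot be cancelled by the others.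
  set m := (s.filter fun i => c i ≠ 0).max' hnon with hm
  have hmem := (s.filter fun i => c i ≠ 0).max'_mem hnon
  rw [← hm, Finset.mem_filter] at hmem
  have hsum : (fun x => ∑ j ∈ s.erase m, c j * f j x) =o[l] f m := by
    refine IsLittleO.fun_sum fun j hj => ?_
    by_cases hcj : c j = 0
    · simp [hcj]
    · have hj' := Finset.mem_erase.1 hj
      have hle : j ≤ m := Finset.le_max' _ _ (by simp [hj'.2, hcj])
      exact (hlt j m (lt_of_le_of_ne hle hj'.1)).const_mul_left _
  have heq : (fun x => ∑ j ∈ s.erase m, c j * f j x) = fun x => (-c m) * f m x := by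
    funext x
    have h := congrFun hc x
    simp only [Finset.sum_apply, Pi.smul_apply, smul_eq_mul, Pi.zero_apply] at h
    rw [← Finset.add_sum_erase _ _ hmem.1] at h
    linarith
  rw [heq, isLittleO_const_mul_left_iff (neg_ne_zero.2 hmem.2)] at hsum
  exact isLittleO_irrefl (hne m) hsum

/-- The exponentials of `m s + v s² / 2` are linearly independent. -/
theorem linearIndependent_exp_quadratic :
    LinearIndependent ℝ (fun (p : ℝ ×ₗ ℝ) (s : ℝ) =>
      Real.exp ((ofLex p).2 * s + (ofLex p).1 * s ^ 2 / 2)) := by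
  refine linearIndependent_of_isLittleO (l := atTop) (fun p q hpq => ?_)
    (fun p => Frequently.of_forall fun x => (Real.exp_pos _).ne')
  rw [Real.isLittleO_exp_comp_exp_comp]
  -- The variance comes first in the lexicographic order because the quadratic term dominates; the
  -- mean breaks ties.
  rcases Prod.Lex.lt_iff.1 hpq with h | ⟨h1, h2⟩
  · have h1 : Tendsto (fun s : ℝ => s * (((ofLex q).1 - (ofLex p).1) / 2 * s
        + ((ofLex q).2 - (ofLex p).2))) atTop atTop :=
      tendsto_id.atTop_mul_atTop₀ (tendsto_atTop_add_const_right _ _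
        (tendsto_id.const_mul_atTop (by linarith)))
    refine h1.congr fun s => by ring
  · have h3 : Tendsto (fun s : ℝ => ((ofLex q).2 - (ofLex p).2) * s) atTop atTop :=
      tendsto_id.const_mul_atTop (by linarith)
    refine h3.congr fun s => by rw [h1]; ring

open Polynomial in
/-- Finitely many functions that are polynomial along lines and do not vanish identically have a
common point where none of them vanishes. -/
theorem exists_forall_ne_zero_of_polynomial_along_lines {V ι : Type*} [AddCommGroup V]
    [Module ℝ V] (f : ι → V → ℝ)
    (hpoly : ∀ i u v, ∃ P : ℝ[X], ∀ x : ℝ, f i (u + x • v) = P.eval x) (s : Finset ι)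
    (hne : ∀ i ∈ s, ∃ v, f i v ≠ 0) : ∃ v, ∀ i ∈ s, f i v ≠ 0 := by
  classical
  induction s using Finset.induction_on with
  | empty => exact ⟨0, by simp⟩
  | insert j s hj ih =>
    obtain ⟨u, hu⟩ := ih fun i hi => hne i (Finset.mem_insert_of_mem hi)
    obtain ⟨w, hw⟩ := hne j (Finset.mem_insert_self _ _)
    -- On the line from `u` to `w`, the old functions are nonzero at parameter 0 and the new one at
    -- parameter 1, so every restriction is a nonzero polynomial, and so is their product.
    choose P hP using fun i => hpoly i u (w - u)
    have hPne : ∀ i ∈ insert j s, P i ≠ 0 := by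
      intro i hi h0
      rcases Finset.mem_insert.1 hi with rfl | hi
      · exact hw (by simpa [h0] using hP i 1)
      · exact hu i hi (by simpa [h0] using hP i 0)
    have hprod : ∏ i ∈ insert j s, P i ≠ 0 := Finset.prod_ne_zero_iff.2 hPne
    obtain ⟨x, hx⟩ : ∃ x, (∏ i ∈ insert j s, P i).eval x ≠ 0 := by
      by_contra! h
      exact hprod (Polynomial.funext fun x => by simpa using h x)
    rw [eval_prod, Finset.prod_ne_zero_iff] at hx
    exact ⟨u + x • (w - u), fun i hi => by rw [hP]; exact hx i hi⟩

variable {E : Type*} [NormedAddCommGroup E] [NormedSpace ℝ E] [MeasurableSpace E]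

/-- The image of `g` under `L` is a real Gaussian, possibly a Dirac mass, whose moment generating
function is explicit. -/
theorem integral_exp_mul_dual (g : Measure E) [IsGaussian g] (L : StrongDual ℝ E) (s : ℝ) :
    ∫ x, Real.exp (s * L x) ∂g = Real.exp ((∫ x, L x ∂g) * s + Var[L; g] * s ^ 2 / 2) := by
  have h := mgf_gaussianReal (IsGaussian.map_eq_gaussianReal (μ := g) L) s
  rw [Real.coe_toNNReal _ (variance_nonneg _ _)] at h
  exact h

variable [BorelSpace E]

theorem integrable_exp_mul_dual (g : Measure E) [IsGaussian g] (L : StrongDual ℝ E) (s : ℝ) :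
    Integrable (fun x => Real.exp (s * L x)) g := by
  have h : Integrable (fun x => Real.exp (s * x)) (g.map L) := by
    rw [IsGaussian.map_eq_gaussianReal]
    exact integrable_exp_mul_gaussianReal s
  exact h.comp_measurable L.continuous.measurable

variable [CompleteSpace E] [SecondCountableTopology E]

open Polynomial in
/-- Finitely many distinct Gaussian measures are separated by the mean and the variance of a
single linear functional. -/
theorem exists_dual_separating (s : Finset {g : Measure E // IsGaussian g}) :
    ∃ L : StrongDual ℝ E, Set.InjOn
      (fun g : {g : Measure E // IsGaussian g} => toLex (Var[L; g.1], ∫ x, L x ∂g.1)) s := by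
  classical
  -- This sum of squares vanishes at `L` exactly when the two Gaussians have the same mean and
  -- variance along `L`. If that held for every `L`, their characteristic functions would agree.
  let f : {g : Measure E // IsGaussian g} × {g : Measure E // IsGaussian g} →
    StrongDual ℝ E → ℝ := fun p L =>
      (L (∫ x, x ∂p.1.1) - L (∫ x, x ∂p.2.1)) ^ 2 +
      (covarianceBilinDual p.1.1 L L - covarianceBilinDual p.2.1 L L) ^ 2
  obtain ⟨L, hL⟩ := exists_forall_ne_zero_of_polynomial_along_lines f (fun p u v => by
    set a := ∫ x, x ∂p.1.1
    set b := ∫ x, x ∂p.2.1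
    refine ⟨(C (u a - u b) + C (v a - v b) * X) ^ 2 +
      (C (covarianceBilinDual p.1.1 u u - covarianceBilinDual p.2.1 u u) +
       C (covarianceBilinDual p.1.1 u v + covarianceBilinDual p.1.1 v u
        - covarianceBilinDual p.2.1 u v - covarianceBilinDual p.2.1 v u) * X +
       C (covarianceBilinDual p.1.1 v v - covarianceBilinDual p.2.1 v v) * X ^ 2) ^ 2,
      fun x => ?_⟩
    simp only [f, map_add, map_smul, add_apply, smul_apply,
      smul_eq_mul, eval_add, eval_mul, eval_pow, eval_C, eval_X]
    ring) (s.offDiag) (fun p hp => by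
      by_contra! h
      have h' : ∀ L : StrongDual ℝ E, L (∫ x, x ∂p.1.1) = L (∫ x, x ∂p.2.1) ∧
          covarianceBilinDual p.1.1 L L = covarianceBilinDual p.2.1 L L := by
        intro L
        have := h L
        simp only [f] at this
        constructor <;> nlinarith [sq_nonneg (L (∫ x, x ∂p.1.1) - L (∫ x, x ∂p.2.1)),
          sq_nonneg (covarianceBilinDual p.1.1 L L - covarianceBilinDual p.2.1 L L)]
      have := p.1.2
      have := p.2.2
      refine (Finset.mem_offDiag.1 hp).2.2 (Subtype.ext (Measure.ext_of_charFunDual ?_))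
      ext L
      rw [IsGaussian.charFunDual_eq', IsGaussian.charFunDual_eq', (h' L).2]
      simp only [id]
      rw [(h' L).1])
  refine ⟨L, fun g hg h hh hgh => ?_⟩
  by_contra hne
  have := g.2
  have := h.2
  refine hL (g, h) (Finset.mem_offDiag.2 ⟨hg, hh, hne⟩) ?_
  have h1 := congrArg (fun p => (ofLex p).1) hgh
  have h2 := congrArg (fun p => (ofLex p).2) hgh
  simp only [ofLex_toLex] at h1 h2
  rw [IsGaussian.integral_dual, IsGaussian.integral_dual] at h2
  simp only [f, h2]
  rw [covarianceBilinDual_self_eq_variance IsGaussian.memLp_two_id,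
    covarianceBilinDual_self_eq_variance IsGaussian.memLp_two_id, h1]
  ring

/-- Distinct Gaussian measures, possibly degenerate, are linearly independent: finite Gaussian
mixtures are identifiable. -/
theorem linearIndependent_isGaussian :
    LinearIndependent ℝ≥0 (Subtype.val : {g : Measure E // IsGaussian g} → Measure E) := by
  classical
  intro a b hab
  set S := a.support ∪ b.support with hS
  obtain ⟨L, hL⟩ := exists_dual_separating S
  have hint : ∀ c : {g : Measure E // IsGaussian g} →₀ ℝ≥0, c.support ⊆ S → ∀ s : ℝ,
      ∫ x, Real.exp (s * L x) ∂(Finsupp.linearCombination ℝ≥0 Subtype.val c) =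
      ∑ g ∈ S, (c g : ℝ) * Real.exp ((∫ x, L x ∂g.1) * s + Var[L; g.1] * s ^ 2 / 2) := by
    intro c hc s
    rw [Finsupp.linearCombination_apply, Finsupp.sum_of_support_subset _ hc _ (by simp),
      integral_finsetSum_measure]
    · refine Finset.sum_congr rfl fun g _ => ?_
      have := g.2
      rw [integral_smul_nnreal_measure, integral_exp_mul_dual, NNReal.smul_def, smul_eq_mul]
    · intro g _
      have := g.2
      exact (integrable_exp_mul_dual g.1 L s).smul_measure_nnreal
  have hli := linearIndependent_exp_quadratic.comp
    (fun g : S => toLex (Var[L; g.1.1], ∫ x, L x ∂g.1.1))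
    (fun g h hgh => Subtype.ext (hL g.2 h.2 hgh))
  rw [Fintype.linearIndependent_iff] at hli
  have hz := hli (fun g => (a g.1 : ℝ) - b g.1) (by
    funext s
    have h1 := hint a Finset.subset_union_left s
    have h2 := hint b Finset.subset_union_right s
    rw [hab, h2] at h1
    simp only [Finset.sum_apply, Pi.smul_apply, Function.comp, ofLex_toLex, smul_eq_mul,
      Pi.zero_apply, sub_mul, Finset.sum_sub_distrib]
    rw [Finset.sum_coe_sort S (fun g => (a g : ℝ) *
        Real.exp ((∫ x, L x ∂g.1) * s + Var[L; g.1] * s ^ 2 / 2)),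
      Finset.sum_coe_sort S (fun g => (b g : ℝ) *
        Real.exp ((∫ x, L x ∂g.1) * s + Var[L; g.1] * s ^ 2 / 2)), h1, sub_self])
  ext g
  by_cases hg : g ∈ S
  · exact sub_eq_zero.1 (hz ⟨g, hg⟩)
  · rw [hS, Finset.mem_union, not_or, Finsupp.notMem_support_iff, Finsupp.notMem_support_iff] at hg
    rw [hg.1, hg.2]

end LinearIndependence

/-! ### Gaussian measures with prescribed moments -/

section GaussianExistence

variable {F G : Type*} [NormedAddCommGroup F] [NormedSpace ℝ F] [MeasurableSpace F] [BorelSpace F]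
  [NormedAddCommGroup G] [NormedSpace ℝ G] [MeasurableSpace G] [BorelSpace G]
  [SecondCountableTopology G]

theorem memLp_id_map {μ : Measure F} {p : ℝ≥0∞} (h : MemLp id p μ) (T : F →L[ℝ] G) :
    MemLp id p (μ.map T) := by
  rw [memLp_map_measure_iff aestronglyMeasurable_id T.continuous.measurable.aemeasurable]
  exact T.comp_memLp' h

variable [CompleteSpace F] [CompleteSpace G]

theorem covarianceBilinDual_map_apply {μ : Measure F} [IsFiniteMeasure μ] (h : MemLp id 2 μ)
    (T : F →L[ℝ] G) (L L' : StrongDual ℝ G) :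
    covarianceBilinDual (μ.map T) L L' = covarianceBilinDual μ (L.comp T) (L'.comp T) := by
  rw [covarianceBilinDual_eq_covariance (memLp_id_map h T), covarianceBilinDual_eq_covariance h,
    covariance_map L.continuous.aestronglyMeasurable L'.continuous.aestronglyMeasurable
      T.continuous.measurable.aemeasurable]
  rfl

theorem integral_map_continuousLinearMap {μ : Measure F} (h : Integrable id μ) (T : F →L[ℝ] G) :
    ∫ x, x ∂(μ.map T) = T (∫ x, x ∂μ) := by
  rw [integral_map (f := fun x : G => x) T.continuous.measurable.aemeasurable
    aestronglyMeasurable_id]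
  exact T.integral_comp_comm h

/-- On a finite dimensional space there is a Gaussian measure with any prescribed mean and any
prescribed positive semidefinite covariance. -/
theorem exists_isGaussian_of_mean_of_covariance [FiniteDimensional ℝ F] (m : F)
    (B : StrongDual ℝ F →L[ℝ] StrongDual ℝ F →L[ℝ] ℝ) (hsymm : ∀ L L', B L L' = B L' L)
    (hnonneg : ∀ L, 0 ≤ B L L) :
    ∃ μ : Measure F, IsGaussian μ ∧ ∫ x, x ∂μ = m ∧ covarianceBilinDual μ = B := by
  have : SecondCountableTopology F :=
    have := FiniteDimensional.proper ℝ F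
    inferInstance
  let ι := Fin (Module.finrank ℝ F)
  let φ : F ≃L[ℝ] EuclideanSpace ℝ ι := toEuclidean
  let ℓ : ι → StrongDual ℝ F := fun i => (EuclideanSpace.proj i).comp φ.toContinuousLinearMap
  let a : StrongDual ℝ F → ι → ℝ := fun L i => L (φ.symm (EuclideanSpace.single i 1))
  have hL : ∀ L : StrongDual ℝ F, L = ∑ i, a L i • ℓ i := by
    intro L
    ext x
    have hx : x = ∑ i, (φ x) i • φ.symm (EuclideanSpace.single i 1) := by
      apply φ.injective
      ext j
      simp [map_sum, Finset.sum_apply, Pi.single_apply]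
    conv_lhs => rw [hx]
    simp [ℓ, a, map_sum, mul_comm]
  have hbil : ∀ (C : StrongDual ℝ F →L[ℝ] StrongDual ℝ F →L[ℝ] ℝ) (u v : ι → ℝ),
      C (∑ i, u i • ℓ i) (∑ j, v j • ℓ j) = ∑ i, ∑ j, u i * v j * C (ℓ i) (ℓ j) := by
    intro C u v
    simp only [map_sum, map_smul, sum_apply, smul_apply, smul_eq_mul,
      Finset.mul_sum]
    rw [Finset.sum_comm]
    exact Finset.sum_congr rfl fun i _ => Finset.sum_congr rfl fun j _ => by ring
  -- The matrix of `B` in the coordinate functionals: the covariance of a Gaussian on Euclidean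
  -- space, to be transported back by `φ.symm`.
  let S : Matrix ι ι ℝ := fun i j => B (ℓ i) (ℓ j)
  have hS : S.PosSemidef := by
    refine Matrix.PosSemidef.of_dotProduct_mulVec_nonneg ?_ fun x => ?_
    · ext i j
      exact hsymm _ _
    · have h := hnonneg (∑ i, x i • ℓ i)
      rw [hbil] at h
      refine h.trans_eq ?_
      simp only [dotProduct, Matrix.mulVec, Finset.mul_sum, S]
      exact Finset.sum_congr rfl fun i _ => Finset.sum_congr rfl fun j _ => by
        rw [Pi.star_apply, star_trivial]; ring
  let ν := multivariateGaussian (φ m) S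
  have hν : MemLp id 2 ν := IsGaussian.memLp_two_id
  refine ⟨ν.map φ.symm.toContinuousLinearMap, inferInstance, ?_, ?_⟩
  · rw [integral_map_continuousLinearMap IsGaussian.integrable_id, integral_id_multivariateGaussian]
    simp
  · ext L L'
    rw [hL L, hL L', hbil, hbil]
    refine Finset.sum_congr rfl fun i _ => Finset.sum_congr rfl fun j _ => ?_
    rw [covarianceBilinDual_map_apply hν, covarianceBilinDual_eq_covariance hν]
    congr 1
    have h := covariance_eval_multivariateGaussian (μ := φ m) hS i j
    convert h using 2 <;> · ext x; simp [ℓ]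

/-- The Gaussian measure with the same first and second moments as `μ` has the same image as `μ`
under every linear map for which the image of `μ` is Gaussian. -/
theorem map_eq_map_of_same_moments [SecondCountableTopology F] {μ ν : Measure F} [IsGaussian ν]
    [IsProbabilityMeasure μ] (hμ : MemLp id 2 μ) (hmean : ∫ x, x ∂ν = ∫ x, x ∂μ)
    (hcov : covarianceBilinDual ν = covarianceBilinDual μ) (T : F →L[ℝ] G)
    [IsGaussian (μ.map T)] : ν.map T = μ.map T := by
  have hν : MemLp id 2 ν := IsGaussian.memLp_two_id
  refine IsGaussian.ext_covarianceBilinDual ?_ ?_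
  · simp only [id]
    rw [integral_map_continuousLinearMap (hν.integrable one_le_two),
      integral_map_continuousLinearMap (hμ.integrable one_le_two), hmean]
  · ext L L'
    rw [covarianceBilinDual_map_apply hν, covarianceBilinDual_map_apply hμ, hcov]

end GaussianExistence

/-! ### Gluing of plans -/

section Gluing

/-- Two plans with a common middle marginal can be glued. -/
theorem exists_glued_measure {X Y Z : Type*} [MeasurableSpace X] [MeasurableSpace Y]
    [MeasurableSpace Z] [StandardBorelSpace Z] [Nonempty Z] (α : Measure (X × Y))
    (β : Measure (Y × Z)) [IsProbabilityMeasure α] [IsProbabilityMeasure β]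
    (h : α.snd = β.fst) :
    ∃ Γ : Measure ((X × Y) × Z), IsProbabilityMeasure Γ ∧ Γ.map Prod.fst = α ∧
      Γ.map (fun p => (p.1.2, p.2)) = β := by
  -- Draw `(x, y)` from `α`, then `z` from the conditional law of `β` given `y`.
  refine ⟨α ⊗ₘ (β.condKernel.comap Prod.snd measurable_snd), inferInstance,
    Measure.fst_compProd _ _, ?_⟩
  have hm : Measurable (fun p : (X × Y) × Z => (p.1.2, p.2)) := by fun_prop
  conv_rhs => rw [← β.disintegrate β.condKernel, ← h]
  ext s hs
  rw [Measure.map_apply hm hs, Measure.compProd_apply (hm hs), Measure.compProd_apply hs,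
    Measure.snd, lintegral_map (Kernel.measurable_kernel_prodMk_left hs) measurable_snd]
  rfl

variable {E : Type*} [NormedAddCommGroup E] [NormedSpace ℝ E] [MeasurableSpace E] [BorelSpace E]
  [FiniteDimensional ℝ E] [CompleteSpace E] [SecondCountableTopology E]

/-- Two Gaussian plans with a common middle marginal can be glued to a Gaussian measure. -/
theorem exists_glued_isGaussian (α β : Measure (E × E)) [IsGaussian α] [IsGaussian β] :
    ∃ Γ : Measure ((E × E) × E), IsGaussian Γ ∧ (α.snd = β.fst →
      Γ.map Prod.fst = α ∧ Γ.map (fun p => (p.1.2, p.2)) = β) := by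
  by_cases h : α.snd = β.fst
  swap
  -- A default value: having a Gaussian for every pair of plans allows a later choice over all
  -- pairs, matched or not.
  · exact ⟨Measure.dirac 0, inferInstance, fun h' => absurd h' h⟩
  obtain ⟨Γ, hΓ, h1, h2⟩ := exists_glued_measure α β h
  let T₁ : ((E × E) × E) →L[ℝ] E × E := .fst ℝ _ _
  let T₂ : ((E × E) × E) →L[ℝ] E × E :=
    ((ContinuousLinearMap.snd ℝ E E).comp (.fst ℝ _ _)).prod (.snd ℝ _ _)
  have hT₁ : Γ.map T₁ = α := h1
  have hT₂ : Γ.map T₂ = β := h2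
  have hg₁ : IsGaussian (Γ.map T₁) := hT₁ ▸ inferInstance
  have hg₂ : IsGaussian (Γ.map T₂) := hT₂ ▸ inferInstance
  have hmem : MemLp id 2 Γ := by
    have m1 : MemLp (fun p => T₁ p) 2 Γ := by
      have := IsGaussian.memLp_two_id (μ := Γ.map T₁)
      rwa [memLp_map_measure_iff aestronglyMeasurable_id T₁.continuous.measurable.aemeasurable]
        at this
    have m2 : MemLp (fun p => T₂ p) 2 Γ := by
      have := IsGaussian.memLp_two_id (μ := Γ.map T₂)
      rwa [memLp_map_measure_iff aestronglyMeasurable_id T₂.continuous.measurable.aemeasurable]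
        at this
    have m3 := (ContinuousLinearMap.inl ℝ (E × E) E).comp_memLp' m1
    have m4 := ((ContinuousLinearMap.inr ℝ (E × E) E).comp (.snd ℝ E E)).comp_memLp' m2
    refine (m3.add m4).ae_eq (Filter.Eventually.of_forall fun p => ?_)
    simp [T₁, T₂]
  -- `Γ` is not known to be Gaussian, but only its first two moments matter for the two Gaussian
  -- projections.
  obtain ⟨G, hG, hGm, hGc⟩ := exists_isGaussian_of_mean_of_covariance (∫ x, x ∂Γ)
    (covarianceBilinDual Γ) covarianceBilinDual_comm covarianceBilinDual_self_nonneg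
  refine ⟨G, hG, fun _ => ⟨?_, ?_⟩⟩
  · exact (map_eq_map_of_same_moments hmem hGm hGc T₁).trans hT₁
  · exact (map_eq_map_of_same_moments hmem hGm hGc T₂).trans hT₂

end Gluing

/-! ### Optimal Gaussian plans between Gaussian measures -/

section OptimalGaussianPlan

set_option maxSynthPendingDepth 3

variable {E : Type*} [NormedAddCommGroup E] [NormedSpace ℝ E]

/-- The symmetric positive semidefinite forms on the dual of `E × E` with given diagonal blocks. -/
def covarianceCouplings (P Q : StrongDual ℝ E →L[ℝ] StrongDual ℝ E →L[ℝ] ℝ) :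
    Set (StrongDual ℝ (E × E) →L[ℝ] StrongDual ℝ (E × E) →L[ℝ] ℝ) :=
  {B | (∀ L L', B L L' = B L' L) ∧ (∀ L, 0 ≤ B L L) ∧
    (∀ L L', B (L.comp (.fst ℝ E E)) (L'.comp (.fst ℝ E E)) = P L L') ∧
    ∀ L L', B (L.comp (.snd ℝ E E)) (L'.comp (.snd ℝ E E)) = Q L L'}

theorem isClosed_covarianceCouplings (P Q : StrongDual ℝ E →L[ℝ] StrongDual ℝ E →L[ℝ] ℝ) :
    IsClosed (covarianceCouplings P Q) := by
  have hc : ∀ L L', Continuous fun B : StrongDual ℝ (E × E) →L[ℝ] StrongDual ℝ (E × E) →L[ℝ] ℝ =>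
      B L L' := fun L L' => by fun_prop
  simp only [covarianceCouplings, Set.ofPred_and, Set.ofPred_forall]
  refine IsClosed.inter ?_ (IsClosed.inter ?_ (IsClosed.inter ?_ ?_))
  · exact isClosed_iInter fun L => isClosed_iInter fun L' => isClosed_eq (hc _ _) (hc _ _)
  · exact isClosed_iInter fun L => isClosed_le continuous_const (hc _ _)
  · exact isClosed_iInter fun L => isClosed_iInter fun L' => isClosed_eq (hc _ _) continuous_const
  · exact isClosed_iInter fun L => isClosed_iInter fun L' => isClosed_eq (hc _ _) continuous_const

/-- Positivity on `u - v` bounds the form at `u + v` by twice the diagonal blocks, by the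
parallelogram identity; Cauchy–Schwarz then bounds the off-diagonal values. -/
theorem norm_le_of_mem_covarianceCouplings
    {P Q : StrongDual ℝ E →L[ℝ] StrongDual ℝ E →L[ℝ] ℝ}
    {B : StrongDual ℝ (E × E) →L[ℝ] StrongDual ℝ (E × E) →L[ℝ] ℝ}
    (hB : B ∈ covarianceCouplings P Q) : ‖B‖ ≤ 2 * (‖P‖ + ‖Q‖) := by
  obtain ⟨hsymm, hnonneg, hP, hQ⟩ := hB
  have hself : ∀ L, B L L ≤ 2 * (‖P‖ + ‖Q‖) * ‖L‖ ^ 2 := by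
    intro L
    set L₁ := L.comp (.inl ℝ E E)
    set L₂ := L.comp (.inr ℝ E E)
    set u := L₁.comp (.fst ℝ E E)
    set v := L₂.comp (.snd ℝ E E)
    have hL : L = u + v := by
      ext x <;> simp [u, v, L₁, L₂, Prod.mk_zero_zero]
    have hn₁ : ‖L₁‖ ≤ ‖L‖ := (L.opNorm_comp_le _).trans
      (mul_le_of_le_one_right (norm_nonneg _) (ContinuousLinearMap.norm_inl_le_one ℝ E E))
    have hn₂ : ‖L₂‖ ≤ ‖L‖ := (L.opNorm_comp_le _).trans
      (mul_le_of_le_one_right (norm_nonneg _) (ContinuousLinearMap.norm_inr_le_one ℝ E E))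
    have h1 := hnonneg (u - v)
    have h2 : B u u ≤ ‖P‖ * ‖L‖ ^ 2 := by
      rw [hP, pow_two, ← mul_assoc]
      refine (le_abs_self _).trans ((P.le_opNorm₂ L₁ L₁).trans ?_)
      gcongr
    have h3 : B v v ≤ ‖Q‖ * ‖L‖ ^ 2 := by
      rw [hQ, pow_two, ← mul_assoc]
      refine (le_abs_self _).trans ((Q.le_opNorm₂ L₂ L₂).trans ?_)
      gcongr
    have h4 : B L L = 2 * B u u + 2 * B v v - B (u - v) (u - v) := by
      rw [hL]
      simp only [map_add, map_sub, add_apply, sub_apply]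
      ring
    linarith
  refine ContinuousLinearMap.opNorm_le_bound₂ _ (by positivity) fun L L' => ?_
  have hcs : B L L' ^ 2 ≤ B L L * B L' L' := by
    have := LinearMap.BilinForm.apply_sq_le_of_symm B.toBilinForm hnonneg ⟨hsymm⟩ L L'
    exact this
  refine abs_le_of_sq_le_sq (hcs.trans ?_) (by positivity)
  calc B L L * B L' L' ≤ (2 * (‖P‖ + ‖Q‖) * ‖L‖ ^ 2) * (2 * (‖P‖ + ‖Q‖) * ‖L'‖ ^ 2) :=
        mul_le_mul (hself L) (hself L') (hnonneg L') (by positivity)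
    _ = _ := by ring

theorem isCompact_covarianceCouplings [FiniteDimensional ℝ E]
    (P Q : StrongDual ℝ E →L[ℝ] StrongDual ℝ E →L[ℝ] ℝ) :
    IsCompact (covarianceCouplings P Q) := by
  have := FiniteDimensional.proper ℝ (StrongDual ℝ (E × E) →L[ℝ] StrongDual ℝ (E × E) →L[ℝ] ℝ)
  refine Metric.isCompact_of_isClosed_isBounded (isClosed_covarianceCouplings P Q) ?_
  exact isBounded_iff_forall_norm_le.2 ⟨_, fun B hB => norm_le_of_mem_covarianceCouplings hB⟩

end OptimalGaussianPlan

section GaussianCost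

set_option maxSynthPendingDepth 3

variable {E : Type*} [NormedAddCommGroup E] [MeasurableSpace E]

/-- Reading the root cost as an L² norm makes Minkowski's inequality and homogeneity available. -/
theorem transportCost_rpow_half (γ : Measure (E × E)) :
    transportCost γ ^ (1 / 2 : ℝ) = eLpNorm (fun z : E × E => z.1 - z.2) 2 γ := by
  rw [eLpNorm_eq_lintegral_rpow_enorm_toReal two_ne_zero ENNReal.ofNat_ne_top, transportCost]
  congr 1
  refine lintegral_congr fun z => ?_
  rw [ENNReal.toReal_ofNat, ENNReal.rpow_ofNat, ← ofReal_norm, ENNReal.ofReal_pow (norm_nonneg _)]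

variable [NormedSpace ℝ E]

instance isGaussian_fst [SecondCountableTopology E] [BorelSpace E] (γ : Measure (E × E))
    [IsGaussian γ] : IsGaussian γ.fst :=
  inferInstanceAs (IsGaussian (γ.map (ContinuousLinearMap.fst ℝ E E)))

instance isGaussian_snd [SecondCountableTopology E] [BorelSpace E] (γ : Measure (E × E))
    [IsGaussian γ] : IsGaussian γ.snd :=
  inferInstanceAs (IsGaussian (γ.map (ContinuousLinearMap.snd ℝ E E)))

theorem mem_covarianceCouplings [CompleteSpace E] [SecondCountableTopology E] [BorelSpace E]
    (γ : Measure (E × E)) [IsGaussian γ] : covarianceBilinDual γ ∈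
      covarianceCouplings (covarianceBilinDual γ.fst) (covarianceBilinDual γ.snd) := by
  refine ⟨covarianceBilinDual_comm, covarianceBilinDual_self_nonneg, fun L L' => ?_,
    fun L L' => ?_⟩
  · exact (covarianceBilinDual_map_apply IsGaussian.memLp_two_id (.fst ℝ E E) L L').symm
  · exact (covarianceBilinDual_map_apply IsGaussian.memLp_two_id (.snd ℝ E E) L L').symm

end GaussianCost

section OptimalGaussianPlan

set_option maxSynthPendingDepth 3

variable {E : Type*} [NormedAddCommGroup E] [InnerProductSpace ℝ E] [MeasurableSpace E]
  [BorelSpace E] [FiniteDimensional ℝ E] [CompleteSpace E] [SecondCountableTopology E]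

/-- The `i`-th coordinate of `x - y`, as a linear functional of `(x, y)`. -/
noncomputable def coordSub (E : Type*) [NormedAddCommGroup E] [InnerProductSpace ℝ E]
    [FiniteDimensional ℝ E] (i : Fin (Module.finrank ℝ E)) : StrongDual ℝ (E × E) :=
  (innerSL ℝ (stdOrthonormalBasis ℝ E i)).comp
    (ContinuousLinearMap.fst ℝ E E - ContinuousLinearMap.snd ℝ E E)

/-- The cost of a Gaussian plan in terms of its marginal means and its covariance. -/
theorem transportCost_eq_covariance (γ : Measure (E × E)) [IsGaussian γ] :
    transportCost γ = ENNReal.ofReal (∑ i, (covarianceBilinDual γ (coordSub E i) (coordSub E i) +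
      coordSub E i (∫ x, x ∂γ.fst, ∫ x, x ∂γ.snd) ^ 2)) := by
  have hmem : MemLp id 2 γ := IsGaussian.memLp_two_id
  have hmean : (∫ x, x ∂γ.fst, ∫ x, x ∂γ.snd) = ∫ z, z ∂γ := by
    have h1 := integral_map_continuousLinearMap (hmem.integrable one_le_two) (.fst ℝ E E)
    have h2 := integral_map_continuousLinearMap (hmem.integrable one_le_two) (.snd ℝ E E)
    exact Prod.ext h1 h2
  have hi : ∀ i, MemLp (coordSub E i) 2 γ := fun i => (coordSub E i).comp_memLp' hmem
  have hsum : ∀ z : E × E, ‖z.1 - z.2‖ ^ 2 = ∑ i, (coordSub E i z) ^ 2 := by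
    intro z
    rw [← (stdOrthonormalBasis ℝ E).sum_sq_norm_inner_right]
    simp [coordSub, inner_sub_right]
  have hint : ∀ i, Integrable (fun z => (coordSub E i z) ^ 2) γ := fun i => (hi i).integrable_sq
  rw [transportCost, ← ofReal_integral_eq_lintegral_ofReal]
  · simp_rw [hsum]
    rw [integral_finsetSum _ fun i _ => hint i]
    congr 1
    refine Finset.sum_congr rfl fun i _ => ?_
    rw [covarianceBilinDual_self_eq_variance hmem, variance_eq_sub (hi i), hmean,
      ← IsGaussian.integral_dual]
    simp
  · simp_rw [hsum]
    exact integrable_finsetSum _ fun i _ => hint i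
  · exact Filter.Eventually.of_forall fun z => by positivity

theorem transportCost_ne_top_of_isGaussian (γ : Measure (E × E)) [IsGaussian γ] :
    transportCost γ ≠ ∞ := by
  rw [transportCost_eq_covariance]
  exact ENNReal.ofReal_ne_top

/-- Among the Gaussian plans between two Gaussian measures there is one of minimal cost. -/
theorem exists_optimal_gaussian_plan (p q : Measure E) [IsGaussian p] [IsGaussian q] :
    ∃ γ : Measure (E × E), IsGaussian γ ∧ γ.fst = p ∧ γ.snd = q ∧
      ∀ γ' : Measure (E × E), IsGaussian γ' → γ'.fst = p → γ'.snd = q →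
        transportCost γ ≤ transportCost γ' := by
  have hne : (covarianceCouplings (covarianceBilinDual p) (covarianceBilinDual q)).Nonempty := by
    have h := mem_covarianceCouplings (p.prod q)
    rw [Measure.fst_prod, Measure.snd_prod] at h
    exact ⟨_, h⟩
  -- The marginals fix the means, so the cost is a continuous function of the covariance alone.
  obtain ⟨B, hB, hmin⟩ := (isCompact_covarianceCouplings (covarianceBilinDual p)
    (covarianceBilinDual q)).exists_isMinOn hne
    (f := fun B => ∑ i, (B (coordSub E i) (coordSub E i) +
      coordSub E i (∫ x, x ∂p, ∫ x, x ∂q) ^ 2)) (by fun_prop)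
  obtain ⟨γ, hγ, hγm, hγc⟩ := exists_isGaussian_of_mean_of_covariance
    (∫ x, x ∂p, ∫ x, x ∂q) B hB.1 hB.2.1
  have hmem : MemLp id 2 γ := IsGaussian.memLp_two_id
  have hfst : γ.fst = p := by
    refine IsGaussian.ext_covarianceBilinDual ?_ ?_
    · exact (integral_map_continuousLinearMap (hmem.integrable one_le_two) (.fst ℝ E E)).trans
        (by rw [hγm]; rfl)
    · ext L L'
      exact (covarianceBilinDual_map_apply hmem (.fst ℝ E E) L L').trans
        (by rw [hγc]; exact hB.2.2.1 L L')
  have hsnd : γ.snd = q := by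
    refine IsGaussian.ext_covarianceBilinDual ?_ ?_
    · exact (integral_map_continuousLinearMap (hmem.integrable one_le_two) (.snd ℝ E E)).trans
        (by rw [hγm]; rfl)
    · ext L L'
      exact (covarianceBilinDual_map_apply hmem (.snd ℝ E E) L L').trans
        (by rw [hγc]; exact hB.2.2.2 L L')
  refine ⟨γ, hγ, hfst, hsnd, fun γ' hγ' h1 h2 => ?_⟩
  rw [transportCost_eq_covariance, transportCost_eq_covariance, hfst, hsnd, h1, h2, hγc]
  refine ENNReal.ofReal_le_ofReal (hmin ?_)
  have h := mem_covarianceCouplings γ'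
  rwa [h1, h2] at h

end OptimalGaussianPlan

/-! ### Couplings of finitely supported weights -/

section DiscreteCouplings

variable {A B C : Type*}

theorem mapDomain_fst_apply [DecidableEq A] [DecidableEq B] {t : A × B →₀ ℝ≥0} {s : Finset A}
    {u : Finset B} (h : t.support ⊆ s ×ˢ u) (x : A) :
    t.mapDomain Prod.fst x = ∑ y ∈ u, t (x, y) := by
  rw [Finsupp.mapDomain, Finsupp.sum_of_support_subset _ h _ (by simp), Finsupp.finsetSum_apply,
    Finset.sum_product, Finset.sum_comm]
  refine Finset.sum_congr rfl fun y _ => ?_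
  rw [Finset.sum_eq_single x]
  · simp
  · intro x' _ hx'
    simp [hx']
  · intro hx
    have : t (x, y) = 0 := by
      by_contra h0
      exact hx (Finset.mem_product.1 (h (Finsupp.mem_support_iff.2 h0))).1
    simp [this]

theorem mapDomain_snd_apply [DecidableEq A] [DecidableEq B] {t : A × B →₀ ℝ≥0} {s : Finset A}
    {u : Finset B} (h : t.support ⊆ s ×ˢ u) (y : B) :
    t.mapDomain Prod.snd y = ∑ x ∈ s, t (x, y) := by
  rw [Finsupp.mapDomain, Finsupp.sum_of_support_subset _ h _ (by simp), Finsupp.finsetSum_apply,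
    Finset.sum_product]
  refine Finset.sum_congr rfl fun x _ => ?_
  rw [Finset.sum_eq_single y]
  · simp
  · intro y' _ hy'
    simp [hy']
  · intro hy
    have : t (x, y) = 0 := by
      by_contra h0
      exact hy (Finset.mem_product.1 (h (Finsupp.mem_support_iff.2 h0))).2
    simp [this]

theorem le_mapDomain_apply (t : A →₀ ℝ≥0) (f : A → C) (x : A) : t x ≤ t.mapDomain f (f x) := by
  classical
  by_cases hx : x ∈ t.support
  · rw [Finsupp.mapDomain, Finsupp.sum, Finsupp.finsetSum_apply]
    calc t x = Finsupp.single (f x) (t x) (f x) := by simp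
      _ ≤ _ := Finset.single_le_sum (f := fun a => Finsupp.single (f a) (t a) (f x))
        (fun _ _ => zero_le) hx
  · rw [Finsupp.notMem_support_iff.1 hx]
    exact zero_le

theorem mapDomain_apply_eq_sum_ite [DecidableEq C] (w : A →₀ ℝ≥0) (k : A → C) (c : C) :
    w.mapDomain k c = ∑ x ∈ w.support, if k x = c then w x else 0 := by
  rw [Finsupp.mapDomain, Finsupp.sum, Finsupp.finsetSum_apply]
  exact Finset.sum_congr rfl fun x _ => by rw [Finsupp.single_apply]

theorem le_one_of_sum_eq_one {w : A →₀ ℝ≥0} (hw : w.sum (fun _ r => r) = 1) (x : A) :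
    w x ≤ 1 := by
  by_cases hx : x ∈ w.support
  · rw [← hw]
    exact Finset.single_le_sum (f := fun x => w x) (fun _ _ => zero_le) hx
  · simp [Finsupp.notMem_support_iff.1 hx]

/-- Finitely supported weights with the same image weights can be coupled over that image. -/
theorem exists_coupling_of_mapDomain_eq (a : A →₀ ℝ≥0) (b : B →₀ ℝ≥0) (f : A → C) (g : B → C)
    (h : a.mapDomain f = b.mapDomain g) :
    ∃ t : A × B →₀ ℝ≥0, t.mapDomain Prod.fst = a ∧ t.mapDomain Prod.snd = b ∧
      ∀ p ∈ t.support, f p.1 = g p.2 := by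
  classical
  -- The independent coupling inside each fibre over `C`, normalised by the mass of the fibre. On a
  -- fibre of mass zero, division by zero returns 0, which is right since `a` and `b` vanish there.
  let τ : A × B → ℝ≥0 := fun p =>
    if f p.1 = g p.2 then a p.1 * b p.2 / a.mapDomain f (f p.1) else 0
  have hsupp : ∀ p, τ p ≠ 0 → p ∈ a.support ×ˢ b.support := by
    intro p hp
    simp only [τ, ne_eq, ite_eq_right_iff, not_forall] at hp
    obtain ⟨_, hp⟩ := hp
    rw [Finset.mem_product, Finsupp.mem_support_iff, Finsupp.mem_support_iff]
    constructor <;> intro h0 <;> simp [h0] at hp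
  let t : A × B →₀ ℝ≥0 := Finsupp.onFinset (a.support ×ˢ b.support) τ hsupp
  have ht : t.support ⊆ a.support ×ˢ b.support := Finsupp.support_onFinset_subset
  refine ⟨t, ?_, ?_, ?_⟩
  · ext x
    rw [mapDomain_fst_apply ht]
    have : ∑ y ∈ b.support, t (x, y) = a x * b.mapDomain g (f x) / a.mapDomain f (f x) := by
      rw [mapDomain_apply_eq_sum_ite b, Finset.mul_sum, Finset.sum_div]
      refine Finset.sum_congr rfl fun y _ => ?_
      change τ (x, y) = _
      simp only [τ]
      by_cases hxy : f x = g y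
      · simp [hxy]
      · simp [hxy, Ne.symm hxy]
    rw [this, ← h]
    by_cases h0 : a.mapDomain f (f x) = 0
    · have := le_mapDomain_apply a f x
      rw [h0] at this
      simp [h0, le_antisymm this zero_le]
    · rw [mul_div_cancel_right₀ _ h0]
  · ext y
    rw [mapDomain_snd_apply ht]
    have : ∑ x ∈ a.support, t (x, y) =
        (∑ x ∈ a.support, if f x = g y then a x else 0) * b y / a.mapDomain f (g y) := by
      rw [Finset.sum_mul, Finset.sum_div]
      refine Finset.sum_congr rfl fun x _ => ?_
      change τ (x, y) = _
      simp only [τ]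
      by_cases hxy : f x = g y
      · simp [hxy]
      · simp [hxy]
    rw [this, ← mapDomain_apply_eq_sum_ite, h]
    by_cases h0 : b.mapDomain g (g y) = 0
    · have := le_mapDomain_apply b g y
      rw [h0] at this
      simp [h0, le_antisymm this zero_le]
    · rw [mul_div_cancel_left₀ _ h0]
  · intro p hp
    rw [Finsupp.mem_support_iff] at hp
    by_contra hne
    exact hp (by change τ p = 0; simp [τ, hne])

/-- The finite optimal transport problem has a solution. -/
theorem exists_optimal_discrete_coupling (a : A →₀ ℝ≥0) (b : B →₀ ℝ≥0)
    (ha : a.sum (fun _ r => r) = 1) (hb : b.sum (fun _ r => r) = 1) (c : A × B → ℝ≥0) :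
    ∃ t : A × B →₀ ℝ≥0, t.mapDomain Prod.fst = a ∧ t.mapDomain Prod.snd = b ∧
      ∀ t' : A × B →₀ ℝ≥0, t'.mapDomain Prod.fst = a → t'.mapDomain Prod.snd = b →
        t.sum (fun p r => r * c p) ≤ t'.sum (fun p r => r * c p) := by
  classical
  -- `A × B` may be infinite; the box bound gives compactness by Tychonoff and confines the support
  -- to the product of the two finite supports.
  let K : Set (A × B → ℝ≥0) :=
    (Set.univ.pi fun p => Set.Icc 0 (min (a p.1) (b p.2))) ∩
      ({τ | ∀ x, ∑ y ∈ b.support, τ (x, y) = a x} ∩ {τ | ∀ y, ∑ x ∈ a.support, τ (x, y) = b y})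
  have hK : IsCompact K := by
    refine (isCompact_univ_pi fun p => isCompact_Icc).inter_right (IsClosed.inter ?_ ?_)
    · simp only [Set.ofPred_forall]
      exact isClosed_iInter fun x => isClosed_eq (by fun_prop) continuous_const
    · simp only [Set.ofPred_forall]
      exact isClosed_iInter fun y => isClosed_eq (by fun_prop) continuous_const
  have hKne : K.Nonempty := by
    -- The product coupling lies in the box because all weights are at most 1.
    refine ⟨fun p => a p.1 * b p.2, fun p _ => ⟨zero_le, le_min ?_ ?_⟩, fun x => ?_, fun y => ?_⟩
    · exact mul_le_of_le_one_right zero_le (le_one_of_sum_eq_one hb _)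
    · exact mul_le_of_le_one_left zero_le (le_one_of_sum_eq_one ha _)
    · simp only
      rw [← Finset.mul_sum]
      exact (congrArg _ hb).trans (mul_one _)
    · simp only
      rw [← Finset.sum_mul]
      exact (congrArg (· * b y) ha).trans (one_mul _)
  obtain ⟨τ, hτ, hmin⟩ := hK.exists_isMinOn hKne
    (f := fun τ => ∑ p ∈ a.support ×ˢ b.support, τ p * c p) (by fun_prop)
  let t : A × B →₀ ℝ≥0 := Finsupp.onFinset (a.support ×ˢ b.support) τ (by
    intro p hp
    have h := (hτ.1 p trivial).2
    rw [le_min_iff] at h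
    rw [Finset.mem_product, Finsupp.mem_support_iff, Finsupp.mem_support_iff]
    constructor <;> intro h0 <;> simp [h0] at h <;> simp [h] at hp)
  have ht : t.support ⊆ a.support ×ˢ b.support := Finsupp.support_onFinset_subset
  refine ⟨t, ?_, ?_, fun t' h1 h2 => ?_⟩
  · ext x
    rw [mapDomain_fst_apply ht, ← hτ.2.1 x]
    rfl
  · ext y
    rw [mapDomain_snd_apply ht, ← hτ.2.2 y]
    rfl
  · have hb1 : ∀ p, t' p ≤ a p.1 := fun p => h1 ▸ le_mapDomain_apply t' Prod.fst p
    have hb2 : ∀ p, t' p ≤ b p.2 := fun p => h2 ▸ le_mapDomain_apply t' Prod.snd p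
    have ht' : t'.support ⊆ a.support ×ˢ b.support := by
      intro p hp
      rw [Finsupp.mem_support_iff] at hp
      rw [Finset.mem_product, Finsupp.mem_support_iff, Finsupp.mem_support_iff]
      have h1 := hb1 p
      have h2 := hb2 p
      constructor <;> intro h0
      · simp [h0, hp] at h1
      · simp [h0, hp] at h2
    rw [Finsupp.sum_of_support_subset _ ht _ (by simp),
      Finsupp.sum_of_support_subset _ ht' _ (by simp)]
    refine hmin (a := t') ⟨fun p _ => ⟨zero_le, le_min (hb1 p) (hb2 p)⟩, fun x => ?_, fun y => ?_⟩
    · rw [← mapDomain_fst_apply ht', h1]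
    · rw [← mapDomain_snd_apply ht', h2]

end DiscreteCouplings

/-! ### Integrals and images of weighted sums of measures -/

section LinearCombination

variable {Ω Ω' ι : Type*} [MeasurableSpace Ω] [MeasurableSpace Ω']

theorem lintegral_linearCombination (m : ι → Measure Ω) (w : ι →₀ ℝ≥0) (f : Ω → ℝ≥0∞) :
    ∫⁻ x, f x ∂(Finsupp.linearCombination ℝ≥0 m w) =
      w.sum fun i r => (r : ℝ≥0∞) * ∫⁻ x, f x ∂m i := by
  rw [Finsupp.linearCombination_apply, Finsupp.sum, lintegral_finsetSum_measure, Finsupp.sum]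
  exact Finset.sum_congr rfl fun i _ => lintegral_smul_measure _ _

theorem map_linearCombination (m : ι → Measure Ω) (w : ι →₀ ℝ≥0) {f : Ω → Ω'}
    (hf : Measurable f) : (Finsupp.linearCombination ℝ≥0 m w).map f =
      Finsupp.linearCombination ℝ≥0 (fun i => (m i).map f) w := by
  ext s hs
  rw [Measure.map_apply hf hs]
  simp only [Finsupp.linearCombination_apply, Finsupp.sum, Measure.finsetSum_apply,
    Measure.smul_apply, Measure.map_apply hf hs]

theorem linearCombination_congr {M : Type*} [AddCommMonoid M] [Module ℝ≥0 M] {m m' : ι → M}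
    {w : ι →₀ ℝ≥0} (h : ∀ i ∈ w.support, m i = m' i) :
    Finsupp.linearCombination ℝ≥0 m w = Finsupp.linearCombination ℝ≥0 m' w := by
  rw [Finsupp.linearCombination_apply, Finsupp.linearCombination_apply]
  exact Finsupp.sum_congr fun i hi => by rw [h i hi]

end LinearCombination

/-! ### Mixtures as weights on Gaussian measures -/

section Mixtures

variable {E F : Type*} [NormedAddCommGroup E] [NormedSpace ℝ E] [MeasurableSpace E]
  [NormedAddCommGroup F] [NormedSpace ℝ F] [MeasurableSpace F]

theorem linearCombination_mem_GMM {ι : Type*} (w : ι →₀ ℝ≥0) (m : ι → Measure E)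
    (hm : ∀ i, IsGaussian (m i)) (hw : w.sum (fun _ r => r) = 1) :
    Finsupp.linearCombination ℝ≥0 m w ∈ GMM E := by
  let e := w.support.equivFin.symm
  refine Set.mem_iUnion.2 ⟨w.support.card, fun k => w (e k), fun k => m (e k), ?_,
    fun k => hm _, ?_⟩
  · rw [e.sum_comp (fun i : w.support => w i), Finset.sum_coe_sort w.support (fun i => w i)]
    exact hw
  · rw [e.sum_comp (fun i : w.support => w i • m i),
      Finset.sum_coe_sort w.support (fun i => w i • m i)]
    rfl

/-- Merging repeated components and dropping zero weights gives the form to which identifiability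
applies. -/
theorem exists_weights_of_mem_GMM {μ : Measure E} (hμ : μ ∈ GMM E) :
    ∃ w : {g : Measure E // IsGaussian g} →₀ ℝ≥0,
      Finsupp.linearCombination ℝ≥0 Subtype.val w = μ ∧ w.sum (fun _ r => r) = 1 := by
  obtain ⟨K, π, g, hπ, hg, rfl⟩ := Set.mem_iUnion.1 hμ
  refine ⟨∑ k, Finsupp.single ⟨g k, hg k⟩ (π k), ?_, ?_⟩
  · simp [map_sum, Finsupp.linearCombination_single]
  · rw [← hπ, ← Finsupp.sum_finsetSum_index (by simp) (by simp)]
    simp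

/-- Linear maps act on each component; this keeps swapped, composed and interpolated plans
admissible. -/
theorem map_mem_GMM [BorelSpace E] [BorelSpace F] {μ : Measure E} (hμ : μ ∈ GMM E)
    (T : E →L[ℝ] F) : μ.map T ∈ GMM F := by
  obtain ⟨w, rfl, hw⟩ := exists_weights_of_mem_GMM hμ
  rw [map_linearCombination _ _ T.continuous.measurable]
  exact linearCombination_mem_GMM w _ (fun g => have := g.2; inferInstance) hw

/-- The first marginal, as a map between Gaussian measures. -/
noncomputable def fstGaussian [SecondCountableTopology E] [BorelSpace E]
    (γ : {γ : Measure (E × E) // IsGaussian γ}) : {g : Measure E // IsGaussian g} :=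
  ⟨γ.1.fst, have := γ.2; inferInstance⟩

/-- The second marginal, as a map between Gaussian measures. -/
noncomputable def sndGaussian [SecondCountableTopology E] [BorelSpace E]
    (γ : {γ : Measure (E × E) // IsGaussian γ}) : {g : Measure E // IsGaussian g} :=
  ⟨γ.1.snd, have := γ.2; inferInstance⟩

variable [BorelSpace E] [CompleteSpace E] [SecondCountableTopology E]

/-- By identifiability, the weights of a mixture of plans project to those of its first marginal. -/
theorem mapDomain_fstGaussian {W : {γ : Measure (E × E) // IsGaussian γ} →₀ ℝ≥0}
    {w : {g : Measure E // IsGaussian g} →₀ ℝ≥0}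
    (h : (Finsupp.linearCombination ℝ≥0 Subtype.val W).fst =
      Finsupp.linearCombination ℝ≥0 Subtype.val w) : W.mapDomain fstGaussian = w := by
  apply linearIndependent_isGaussian
  rw [← h, Finsupp.linearCombination_mapDomain, Measure.fst,
    map_linearCombination _ _ measurable_fst]
  rfl

/-- By identifiability, the weights of a mixture of plans project to those of its second
marginal. -/
theorem mapDomain_sndGaussian {W : {γ : Measure (E × E) // IsGaussian γ} →₀ ℝ≥0}
    {w : {g : Measure E // IsGaussian g} →₀ ℝ≥0}
    (h : (Finsupp.linearCombination ℝ≥0 Subtype.val W).snd =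
      Finsupp.linearCombination ℝ≥0 Subtype.val w) : W.mapDomain sndGaussian = w := by
  apply linearIndependent_isGaussian
  rw [← h, Finsupp.linearCombination_mapDomain, Measure.snd,
    map_linearCombination _ _ measurable_snd]
  rfl

/-- Two mixture plans with a common middle marginal can be glued to a Gaussian mixture. -/
theorem exists_glued_mixture [FiniteDimensional ℝ E] {α β : Measure (E × E)}
    (hα : α ∈ GMM (E × E)) (hβ : β ∈ GMM (E × E)) (h : α.snd = β.fst) :
    ∃ Γ ∈ GMM ((E × E) × E), Γ.map Prod.fst = α ∧ Γ.map (fun p => (p.1.2, p.2)) = β := by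
  obtain ⟨a, rfl, ha⟩ := exists_weights_of_mem_GMM hα
  obtain ⟨b, rfl, hb⟩ := exists_weights_of_mem_GMM hβ
  -- Identifiability makes the two weights induced on the middle Gaussians equal, so components can
  -- be paired only when their middle marginals coincide.
  obtain ⟨t, hta, htb, ht⟩ := exists_coupling_of_mapDomain_eq a b sndGaussian fstGaussian (by
    refine mapDomain_sndGaussian (h.trans ?_)
    rw [Finsupp.linearCombination_mapDomain, Measure.fst, map_linearCombination _ _ measurable_fst]
    rfl)
  choose G hG hGm using fun p : {γ : Measure (E × E) // IsGaussian γ} ×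
      {γ : Measure (E × E) // IsGaussian γ} =>
    have := p.1.2
    have := p.2.2
    exists_glued_isGaussian p.1.1 p.2.1
  have hglue := fun p hp => hGm p (congrArg Subtype.val (ht p hp))
  refine ⟨Finsupp.linearCombination ℝ≥0 G t, linearCombination_mem_GMM t G hG ?_, ?_, ?_⟩
  · rw [← ha, ← hta, Finsupp.sum_mapDomain_index (by simp) (by simp)]
  · rw [map_linearCombination _ _ measurable_fst, ← hta, Finsupp.linearCombination_mapDomain]
    exact linearCombination_congr fun p hp => (hglue p hp).1
  · rw [map_linearCombination _ _ (by fun_prop), ← htb, Finsupp.linearCombination_mapDomain]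
    exact linearCombination_congr fun p hp => (hglue p hp).2

/-- Mixture plans can be composed, and the square root of the cost is subadditive. -/
theorem exists_composed_plan [FiniteDimensional ℝ E] {μ₀ μ₁ μ₂ : Measure E}
    {α β : Measure (E × E)} (hα : α ∈ gmmPlans μ₀ μ₁) (hβ : β ∈ gmmPlans μ₁ μ₂) :
    ∃ γ ∈ gmmPlans μ₀ μ₂, transportCost γ ^ (1 / 2 : ℝ) ≤
      transportCost α ^ (1 / 2 : ℝ) + transportCost β ^ (1 / 2 : ℝ) := by
  obtain ⟨Γ, hΓ, h1, h2⟩ := exists_glued_mixture hα.2 hβ.2 (hα.1.2.trans hβ.1.1.symm)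
  let T : ((E × E) × E) →L[ℝ] E × E :=
    ((ContinuousLinearMap.fst ℝ E E).comp (.fst ℝ _ _)).prod (.snd ℝ _ _)
  have hT : Measurable (fun p : (E × E) × E => (p.1.1, p.2)) := by fun_prop
  have hT' : Measurable (fun p : (E × E) × E => (p.1.2, p.2)) := by fun_prop
  have hsub : Measurable fun z : E × E => z.1 - z.2 := by fun_prop
  refine ⟨Γ.map (fun p => (p.1.1, p.2)), ⟨⟨?_, ?_⟩, map_mem_GMM hΓ T⟩, ?_⟩
  · rw [← hα.1.1, ← h1, Measure.fst, Measure.fst, Measure.map_map measurable_fst hT,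
      Measure.map_map measurable_fst measurable_fst]
    rfl
  · rw [← hβ.1.2, ← h2, Measure.snd, Measure.snd, Measure.map_map measurable_snd hT,
      Measure.map_map measurable_snd hT']
    rfl
  · rw [transportCost_rpow_half, transportCost_rpow_half, transportCost_rpow_half, ← h1, ← h2,
      eLpNorm_map_measure hsub.aestronglyMeasurable hT.aemeasurable,
      eLpNorm_map_measure hsub.aestronglyMeasurable measurable_fst.aemeasurable,
      eLpNorm_map_measure hsub.aestronglyMeasurable hT'.aemeasurable]
    -- Minkowski's inequality for `x - z = (x - y) + (y - z)` under the glued measure.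
    refine le_of_eq_of_le ?_ (eLpNorm_add_le (hsub.comp measurable_fst).aestronglyMeasurable
      (hsub.comp hT').aestronglyMeasurable one_le_two)
    congr 1
    funext p
    simp

end Mixtures

/-! ### Elementary operations on plans -/

section Plans

variable {E : Type*} [NormedAddCommGroup E] [NormedSpace ℝ E] [MeasurableSpace E]

theorem IsOptimalPlan.MW₂_eq {μ ν : Measure E} {γ : Measure (E × E)} (h : IsOptimalPlan μ ν γ) :
    MW₂ μ ν = transportCost γ ^ (1 / 2 : ℝ) := by
  rw [MW₂]
  congr 1
  exact le_antisymm (iInf₂_le γ h.1) (le_iInf₂ h.2)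

theorem MW₂_le_of_mem_gmmPlans {μ ν : Measure E} {γ : Measure (E × E)} (h : γ ∈ gmmPlans μ ν) :
    MW₂ μ ν ≤ transportCost γ ^ (1 / 2 : ℝ) :=
  ENNReal.rpow_le_rpow (iInf₂_le γ h) (by norm_num)

theorem map_interp_zero (γ : Measure (E × E)) : γ.map (interp 0) = γ.fst := by
  rw [Measure.fst]
  congr 1
  funext z
  simp [interp]

theorem map_interp_one (γ : Measure (E × E)) : γ.map (interp 1) = γ.snd := by
  rw [Measure.snd]
  congr 1
  funext z
  simp [interp]

variable [BorelSpace E] [SecondCountableTopology E]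

theorem swap_mem_gmmPlans {μ ν : Measure E} {γ : Measure (E × E)} (h : γ ∈ gmmPlans μ ν) :
    γ.map Prod.swap ∈ gmmPlans ν μ :=
  ⟨⟨Measure.fst_map_swap.trans h.1.2, Measure.snd_map_swap.trans h.1.1⟩,
    map_mem_GMM h.2 (ContinuousLinearEquiv.prodComm ℝ E E).toContinuousLinearMap⟩

theorem transportCost_swap {E : Type*} [NormedAddCommGroup E] [MeasurableSpace E] [BorelSpace E]
    [SecondCountableTopology E] (γ : Measure (E × E)) :
    transportCost (γ.map Prod.swap) = transportCost γ := by
  rw [transportCost, lintegral_map (by fun_prop) measurable_swap]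
  refine lintegral_congr fun z => ?_
  rw [Prod.fst_swap, Prod.snd_swap, norm_sub_rev]

theorem MW₂_comm (μ ν : Measure E) : MW₂ μ ν = MW₂ ν μ := by
  have h : ∀ μ ν : Measure E, (⨅ γ ∈ gmmPlans μ ν, transportCost γ) ≤
      ⨅ γ ∈ gmmPlans ν μ, transportCost γ := fun μ ν => le_iInf₂ fun γ hγ =>
    transportCost_swap γ ▸ iInf₂_le _ (swap_mem_gmmPlans hγ)
  rw [MW₂, MW₂, le_antisymm (h μ ν) (h ν μ)]

theorem map_interp_mem_GMM {γ : Measure (E × E)} (hγ : γ ∈ GMM (E × E)) (t : ℝ) :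
    γ.map (interp t) ∈ GMM E :=
  map_mem_GMM hγ ((1 - t) • ContinuousLinearMap.fst ℝ E E + t • ContinuousLinearMap.snd ℝ E E)

/-- The maps `interp s` and `interp t` send a plan to a plan between the interpolated measures. -/
theorem MW₂_map_interp_le {γ : Measure (E × E)} (hγ : γ ∈ GMM (E × E)) (s t : ℝ) :
    MW₂ (γ.map (interp s)) (γ.map (interp t)) ≤
      ENNReal.ofReal |t - s| * transportCost γ ^ (1 / 2 : ℝ) := by
  let P : ℝ → (E × E) →L[ℝ] E := fun r =>
    (1 - r) • ContinuousLinearMap.fst ℝ E E + r • ContinuousLinearMap.snd ℝ E E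
  have hP : ∀ r, Measurable (interp (E := E) r) := fun r => (P r).continuous.measurable
  have hpair : Measurable fun z : E × E => (interp s z, interp t z) := (hP s).prodMk (hP t)
  have hplan : γ.map (fun z => (interp s z, interp t z)) ∈
      gmmPlans (γ.map (interp s)) (γ.map (interp t)) :=
    ⟨⟨Measure.fst_map_prodMk (hP t), Measure.snd_map_prodMk (hP s)⟩,
      map_mem_GMM hγ ((P s).prod (P t))⟩
  have hsub : Measurable fun z : E × E => z.1 - z.2 := by fun_prop
  refine (MW₂_le_of_mem_gmmPlans hplan).trans_eq ?_
  rw [transportCost_rpow_half, transportCost_rpow_half,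
    eLpNorm_map_measure hsub.aestronglyMeasurable hpair.aemeasurable]
  have : ((fun z : E × E => z.1 - z.2) ∘ fun z : E × E => (interp s z, interp t z)) =
      (t - s) • fun z : E × E => z.1 - z.2 := by
    funext z
    simp only [Function.comp, interp, Pi.smul_apply]
    module
  rw [this, eLpNorm_const_smul, Real.enorm_eq_ofReal_abs]

theorem MW₂_self {μ : Measure E} (hμ : μ ∈ GMM E) : MW₂ μ μ = 0 := by
  have hd : Measurable fun x : E => (x, x) := by fun_prop
  have hplan : μ.map (fun x => (x, x)) ∈ gmmPlans μ μ := by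
    refine ⟨⟨?_, ?_⟩, map_mem_GMM hμ ((ContinuousLinearMap.id ℝ E).prod (.id ℝ E))⟩
    · exact (Measure.fst_map_prodMk measurable_id).trans Measure.map_id
    · exact (Measure.snd_map_prodMk measurable_id).trans Measure.map_id
  refine le_antisymm ((MW₂_le_of_mem_gmmPlans hplan).trans_eq ?_) zero_le
  rw [transportCost, lintegral_map (by fun_prop) hd]
  simp

end Plans

/-! ### Existence of minimisers and the metric axioms -/

section MixtureDistance

variable {E : Type*} [NormedAddCommGroup E] [InnerProductSpace ℝ E] [MeasurableSpace E]
  [BorelSpace E] [FiniteDimensional ℝ E] [CompleteSpace E] [SecondCountableTopology E]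

theorem transportCost_ne_top {γ : Measure (E × E)} (hγ : γ ∈ GMM (E × E)) :
    transportCost γ ≠ ∞ := by
  obtain ⟨w, rfl, -⟩ := exists_weights_of_mem_GMM hγ
  rw [transportCost, lintegral_linearCombination]
  refine ENNReal.sum_ne_top.2 fun g _ => ENNReal.mul_ne_top ENNReal.coe_ne_top ?_
  have := g.2
  exact transportCost_ne_top_of_isGaussian g.1

/-- The infimum defining `MW₂` is attained. -/
theorem exists_isOptimalPlan {μ ν : Measure E} (hμ : μ ∈ GMM E) (hν : ν ∈ GMM E) :
    ∃ γ, IsOptimalPlan μ ν γ := by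
  obtain ⟨a, rfl, ha⟩ := exists_weights_of_mem_GMM hμ
  obtain ⟨b, rfl, hb⟩ := exists_weights_of_mem_GMM hν
  choose G hG hfst hsnd hmin using fun p : {g : Measure E // IsGaussian g} ×
      {g : Measure E // IsGaussian g} =>
    have := p.1.2
    have := p.2.2
    exists_optimal_gaussian_plan p.1.1 p.2.1
  have hfin : ∀ p, transportCost (G p) ≠ ∞ := fun p =>
    have := hG p
    transportCost_ne_top_of_isGaussian _
  obtain ⟨t, hta, htb, ht⟩ := exists_optimal_discrete_coupling a b ha hb
    fun p => (transportCost (G p)).toNNReal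
  have hcoe : ∀ t : {g : Measure E // IsGaussian g} × {g : Measure E // IsGaussian g} →₀ ℝ≥0,
      t.sum (fun p r => (r : ℝ≥0∞) * transportCost (G p)) =
        ((t.sum fun p r => r * (transportCost (G p)).toNNReal : ℝ≥0) : ℝ≥0∞) := by
    intro t
    simp only [Finsupp.sum, ENNReal.ofNNReal_finsetSum, ENNReal.coe_mul,
      ENNReal.coe_toNNReal (hfin _)]
  refine ⟨Finsupp.linearCombination ℝ≥0 G t, ⟨⟨?_, ?_⟩, linearCombination_mem_GMM t G hG ?_⟩, ?_⟩
  · rw [Measure.fst, map_linearCombination _ _ measurable_fst, ← hta,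
      Finsupp.linearCombination_mapDomain]
    exact linearCombination_congr fun p _ => hfst p
  · rw [Measure.snd, map_linearCombination _ _ measurable_snd, ← htb,
      Finsupp.linearCombination_mapDomain]
    exact linearCombination_congr fun p _ => hsnd p
  · rw [← ha, ← hta, Finsupp.sum_mapDomain_index (by simp) (by simp)]
  · rintro γ' ⟨⟨h1, h2⟩, hγ'⟩
    obtain ⟨W, rfl, -⟩ := exists_weights_of_mem_GMM hγ'
    -- By identifiability the weights of a competitor project to a coupling of `a` and `b`;
    -- replacing each of its components by the optimal Gaussian plan with the same marginals does
    -- not raise the cost.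
    have hle := ht (W.mapDomain fun γ => (fstGaussian γ, sndGaussian γ))
      (by rw [← Finsupp.mapDomain_comp]; exact mapDomain_fstGaussian h1)
      (by rw [← Finsupp.mapDomain_comp]; exact mapDomain_sndGaussian h2)
    rw [← ENNReal.coe_le_coe, ← hcoe, ← hcoe,
      Finsupp.sum_mapDomain_index (by simp) (by simp [add_mul])] at hle
    rw [transportCost, transportCost, lintegral_linearCombination, lintegral_linearCombination]
    refine hle.trans (Finset.sum_le_sum fun γ _ => ?_)
    exact mul_le_mul_right (hmin _ γ.1 γ.2 rfl rfl) _

theorem MW₂_ne_top {μ ν : Measure E} (hμ : μ ∈ GMM E) (hν : ν ∈ GMM E) : MW₂ μ ν ≠ ∞ := by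
  obtain ⟨γ, hγ⟩ := exists_isOptimalPlan hμ hν
  rw [hγ.MW₂_eq]
  exact ENNReal.rpow_ne_top_of_nonneg (by norm_num) (transportCost_ne_top hγ.1.2)

theorem MW₂_triangle {μ₀ μ₁ μ₂ : Measure E} (h₀ : μ₀ ∈ GMM E) (h₁ : μ₁ ∈ GMM E)
    (h₂ : μ₂ ∈ GMM E) : MW₂ μ₀ μ₂ ≤ MW₂ μ₀ μ₁ + MW₂ μ₁ μ₂ := by
  obtain ⟨α, hα⟩ := exists_isOptimalPlan h₀ h₁
  obtain ⟨β, hβ⟩ := exists_isOptimalPlan h₁ h₂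
  obtain ⟨γ, hγ, hle⟩ := exists_composed_plan hα.1 hβ.1
  rw [hα.MW₂_eq, hβ.MW₂_eq]
  exact (MW₂_le_of_mem_gmmPlans hγ).trans hle

/-- Because the infimum is attained, some plan has cost exactly zero; the two projections agree
almost everywhere for it. -/
theorem eq_of_MW₂_eq_zero {μ ν : Measure E} (hμ : μ ∈ GMM E) (hν : ν ∈ GMM E)
    (h : MW₂ μ ν = 0) : μ = ν := by
  obtain ⟨γ, hγ⟩ := exists_isOptimalPlan hμ hν
  rw [hγ.MW₂_eq, ENNReal.rpow_eq_zero_iff_of_pos (by norm_num), transportCost,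
    lintegral_eq_zero_iff (by fun_prop)] at h
  have hae : (Prod.fst : E × E → E) =ᵐ[γ] Prod.snd := by
    filter_upwards [h] with z hz
    have : ‖z.1 - z.2‖ ^ 2 ≤ 0 := by simpa using hz
    have h0 : ‖z.1 - z.2‖ = 0 := by
      have := sq_nonneg ‖z.1 - z.2‖
      exact pow_eq_zero_iff two_ne_zero |>.1 (le_antisymm ‹_› this)
    exact sub_eq_zero.1 (norm_eq_zero.1 h0)
  rw [← hγ.1.1.1, ← hγ.1.1.2, Measure.fst, Measure.snd, Measure.map_congr hae]

/-- Finite Gaussian mixtures with the distance `MW₂`. -/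
@[reducible]
noncomputable def gmmEMetricSpace (E : Type*) [NormedAddCommGroup E] [InnerProductSpace ℝ E]
    [MeasurableSpace E] [BorelSpace E] [FiniteDimensional ℝ E] [CompleteSpace E]
    [SecondCountableTopology E] : EMetricSpace (GMM E) where
  edist μ ν := MW₂ μ.1 ν.1
  edist_self μ := MW₂_self μ.2
  edist_comm μ ν := MW₂_comm μ.1 ν.1
  edist_triangle μ₀ μ₁ μ₂ := MW₂_triangle μ₀.2 μ₁.2 μ₂.2
  eq_of_edist_eq_zero {μ ν} h := Subtype.ext (eq_of_MW₂_eq_zero μ.2 ν.2 h)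

/-- Finite Gaussian mixtures with the distance `MW₂`. -/
@[reducible]
noncomputable def gmmMetricSpace (E : Type*) [NormedAddCommGroup E] [InnerProductSpace ℝ E]
    [MeasurableSpace E] [BorelSpace E] [FiniteDimensional ℝ E] [CompleteSpace E]
    [SecondCountableTopology E] : MetricSpace (GMM E) :=
  letI := gmmEMetricSpace E
  EMetricSpace.toMetricSpace fun μ ν => MW₂_ne_top μ.2 ν.2

end MixtureDistance

/-! ### Constant speed and length in metric spaces -/

section ConstantSpeed

variable {X : Type*} [MetricSpace X]

/-- A path on `[0, 1]` whose Lipschitz constant is the distance of its end points has constant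
speed. -/
theorem isConstantSpeedGeodesic_of_dist_le {x y : X} (ρ : Path x y)
    (h : ∀ s t : I, dist (ρ s) (ρ t) ≤ |(t : ℝ) - s| * dist x y) : IsConstantSpeedGeodesic ρ := by
  -- The pieces before `s` and after `t` cost at most `s` and `1 - t` times the total distance, so
  -- the middle piece must account for the rest.
  have key : ∀ s t : I, (s : ℝ) ≤ t → |(t : ℝ) - s| * dist x y ≤ dist (ρ s) (ρ t) := by
    intro s t hst
    have h0 := h 0 s
    have h1 := h t 1
    have htri := dist_triangle4 x (ρ s) (ρ t) y
    rw [ρ.source, Set.Icc.coe_zero, sub_zero, abs_of_nonneg s.2.1] at h0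
    rw [ρ.target, Set.Icc.coe_one, abs_of_nonneg (sub_nonneg.2 t.2.2)] at h1
    rw [abs_of_nonneg (sub_nonneg.2 hst)]
    linarith
  intro s t
  refine le_antisymm (h s t) ?_
  rcases le_total (s : ℝ) t with hst | hst
  · exact key s t hst
  · rw [dist_comm (ρ s), abs_sub_comm]
    exact key t s hst

/-- Along a subdivision the distances telescope to at most the total distance; the two end points
alone give the reverse bound. -/
theorem IsConstantSpeedGeodesic.pathLength_eq {x y : X} {ρ : Path x y}
    (h : IsConstantSpeedGeodesic ρ) : pathLength ρ = edist x y := by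
  refine le_antisymm ?_ ?_
  · refine iSup_le fun ⟨n, u, hu, _⟩ => ?_
    have hstep : ∀ i, 0 ≤ (u (i + 1) : ℝ) - u i := fun i => sub_nonneg.2 (hu (Nat.le_succ i))
    have hterm : ∀ i, edist (ρ (u (i + 1))) (ρ (u i)) =
        ENNReal.ofReal (((u (i + 1) : ℝ) - u i) * dist x y) := by
      intro i
      rw [edist_comm, edist_dist, h, abs_of_nonneg (hstep i)]
    simp only [hterm]
    rw [← ENNReal.ofReal_sum_of_nonneg fun i _ => mul_nonneg (hstep i) dist_nonneg,
      ← Finset.sum_mul, Finset.sum_range_sub (fun i => (u i : ℝ)), edist_dist]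
    refine ENNReal.ofReal_le_ofReal (mul_le_of_le_one_left dist_nonneg ?_)
    linarith [(u n).2.2, (u 0).2.1]
  · have := eVariationOn.edist_le ρ (Set.mem_univ (0 : I)) (Set.mem_univ (1 : I))
    rwa [ρ.source, ρ.target] at this

end ConstantSpeed

/-! ### Displacement interpolation and the main theorem -/

section Geodesics

variable {E : Type*} [NormedAddCommGroup E] [InnerProductSpace ℝ E] [MeasurableSpace E]
  [BorelSpace E] [FiniteDimensional ℝ E] [CompleteSpace E] [SecondCountableTopology E]

/-- The displacement interpolation of an optimal plan is a constant speed geodesic. -/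
theorem exists_path_of_isOptimalPlan {μ₀ μ₁ : GMM E} {γ : Measure (E × E)}
    (hγ : IsOptimalPlan μ₀.1 μ₁.1 γ) :
    letI := gmmMetricSpace E
    ∃ ρ : Path μ₀ μ₁, (∀ t : I, (ρ t).1 = γ.map (interp (t : ℝ))) ∧
      IsConstantSpeedGeodesic ρ := by
  let := gmmMetricSpace E
  let f : I → GMM E := fun t => ⟨γ.map (interp (t : ℝ)), map_interp_mem_GMM hγ.1.2 t⟩
  have hf : ∀ s t : I, dist (f s) (f t) ≤ |(t : ℝ) - s| * dist μ₀ μ₁ := by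
    intro s t
    have h : edist (f s) (f t) ≤ ENNReal.ofReal |(t : ℝ) - s| * edist μ₀ μ₁ :=
      (MW₂_map_interp_le hγ.1.2 s t).trans_eq (by rw [← hγ.MW₂_eq]; rfl)
    rw [edist_dist, edist_dist, ← ENNReal.ofReal_mul (abs_nonneg _)] at h
    exact (ENNReal.ofReal_le_ofReal_iff (by positivity)).1 h
  have hcont : Continuous f := by
    refine (LipschitzWith.of_dist_le_mul (K := ⟨dist μ₀ μ₁, dist_nonneg⟩) fun s t => ?_).continuous
    refine (hf s t).trans_eq ?_
    rw [mul_comm, abs_sub_comm]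
    rfl
  let ρ : Path μ₀ μ₁ :=
    { toFun := f
      continuous_toFun := hcont
      source' := Subtype.ext ((congrArg (fun r => γ.map (interp r)) Set.Icc.coe_zero).trans
        ((map_interp_zero γ).trans hγ.1.1.1))
      target' := Subtype.ext ((congrArg (fun r => γ.map (interp r)) Set.Icc.coe_one).trans
        ((map_interp_one γ).trans hγ.1.1.2)) }
  exact ⟨ρ, fun t => rfl, isConstantSpeedGeodesic_of_dist_le ρ hf⟩

end Geodesics

theorem mainTheorem2 (d : ℕ) :
    ∃ _ : MetricSpace (GMM (EuclideanSpace ℝ (Fin d))),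
      (∀ μ ν : GMM (EuclideanSpace ℝ (Fin d)), edist μ ν = MW₂ μ.1 ν.1) ∧
      IsGeodesicSpace (GMM (EuclideanSpace ℝ (Fin d))) ∧
      ∀ μ₀ μ₁ : GMM (EuclideanSpace ℝ (Fin d)),
        (∃ γ, IsOptimalPlan μ₀.1 μ₁.1 γ) ∧
        ∀ γ, IsOptimalPlan μ₀.1 μ₁.1 γ →
          ∃ ρ : Path μ₀ μ₁,
            (∀ t : unitInterval, (ρ t).1 = γ.map (interp (t : ℝ))) ∧
            IsConstantSpeedGeodesic ρ ∧
            pathLength ρ = edist μ₀ μ₁ := by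
  let := gmmMetricSpace (EuclideanSpace ℝ (Fin d))
  have hgeo : ∀ (μ₀ μ₁ : GMM (EuclideanSpace ℝ (Fin d))) γ, IsOptimalPlan μ₀.1 μ₁.1 γ →
      ∃ ρ : Path μ₀ μ₁, (∀ t : unitInterval, (ρ t).1 = γ.map (interp (t : ℝ))) ∧
        IsConstantSpeedGeodesic ρ ∧ pathLength ρ = edist μ₀ μ₁ := by
    intro μ₀ μ₁ γ hγ
    obtain ⟨ρ, h1, h2⟩ := exists_path_of_isOptimalPlan hγ
    exact ⟨ρ, h1, h2, h2.pathLength_eq⟩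
  refine ⟨inferInstance, fun μ ν => rfl, fun μ₀ μ₁ => ?_,
    fun μ₀ μ₁ => ⟨exists_isOptimalPlan μ₀.2 μ₁.2, hgeo μ₀ μ₁⟩⟩
  obtain ⟨γ, hγ⟩ := exists_isOptimalPlan μ₀.2 μ₁.2
  obtain ⟨ρ, -, -, h⟩ := hgeo μ₀ μ₁ γ hγ
  exact ⟨ρ, h⟩
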